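/- **Conventions.** Let $\Gamma$ be a discrete semigroup. A *$\Gamma$-system* $\mathbf X=(X,\Sigma,\mu,T)$ is a standard Borel probability space $(X,\Sigma,\mu)$ with an action of $\Gamma$ by measurable $\mu$-preserving maps $T^\gamma:X\to X$, $T^{\gamma\gamma'}=T^\gamma T^{\gamma'}$. A *factor map* $\pi:(X,\Sigma,\mu,T)\to(Y,\Phi,\nu,S)$ is a measurable map with $\pi_\#\mu=\nu$ and, for every $\gamma\in\Gamma$, $\pi\circ T^\gamma=S^\gamma\circ\pi$ $\mu$-almost everywhere; one then calls $\mathbf X$ (with $\pi$) an *extension* of $\mathbf Y$. Write $\sigma(\pi)=\{\pi^{-1}(A):A\in\Phi\}$. A factor map $\pi$ *contains* a factor map $\psi$ on the same system if every set of $\sigma(\psi)$ agrees with a set of $\sigma(\pi)$ up to a $\mu$-null set, and a family of factor maps $\pi_i$ on $\mathbf X$ *generates the whole of $\mathbf X$* if every set of $\Sigma$ agrees with a set of $\bigvee_i\sigma(\pi_i)$ up to a $\mu$-null set. A *joining* of $\mathbf X_1,\dots,\mathbf X_k$ is a system with factor maps to the $\mathbf X_i$ that generate the whole of it. An *inverse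 sequence* is a sequence $(\mathbf X_m)_{m\ge0}$ with factor maps $\psi^m_k:\mathbf X_m\to\mathbf X_k$ $(m\ge k)$ such that $\psi^k_l\circ\psi^m_k=\psi^m_l$ a.e.; an *inverse limit* of it is a system $\mathbf X$ with factor maps $\psi_m:\mathbf X\to\mathbf X_m$ such that $\psi^m_k\circ\psi_m=\psi_k$ a.e. and the $\psi_m$ generate the whole of $\mathbf X$. A class $\mathsf C$ of $\Gamma$-systems is *idempotent* if it contains the trivial (one-point) system and is closed under measure-theoretic isomorphism, inverse limits and joinings. In that case each system $\mathbf X$ has a *maximal $\mathsf C$-factor* $\zeta^{\mathbf X}_{\mathsf C}:\mathbf X\to\mathsf C\mathbf X$, unique up to null sets: a factor map to a member of $\mathsf C$ that contains every factor map from $\mathbf X$ to a member of $\mathsf C$. A system $\mathbf X$ is *$\mathsf C$-sated* if for every extension $\pi:\tilde{\mathbf X}\to\mathbf X$ the factor maps $\pi$ and $\zeta^{\tilde{\mathbf X}}_{\mathsf C}$ are relatively independent over $\zeta^{\mathbf X}_{\mathsf C}\circ\pi$, that is, for all $f,g\in L^\infty(\tilde\mu)$ with $f$ $\sigma(\pi)$-measurable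 and $g$ $\sigma(\zeta^{\tilde{\mathbf X}}_{\mathsf C})$-measurable, $$\int fg\,d\tilde\mu=\int \mathsf E_{\tilde\mu}(f\mid\zeta^{\mathbf X}_{\mathsf C}\circ\pi)\,\mathsf E_{\tilde\mu}(g\mid\zeta^{\mathbf X}_{\mathsf C}\circ\pi)\,d\tilde\mu .$$ **Theorem (Idempotent classes admit multiply sated extensions).** Let $(\mathsf C_i)_{i\in I}$ be a countable family of idempotent classes of $\Gamma$-systems. Then every $\Gamma$-system $\mathbf X_0$ admits an extension $\pi:\mathbf X\to\mathbf X_0$ such that - $\mathbf X$ is $\mathsf C_i$-sated for every $i\in I$; - the factor maps $\pi$ and $\zeta^{\mathbf X}_{\mathsf C_i}$ $(i\in I)$ together generate the whole of $\mathbf X$. -/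

import Mathlib

open MeasureTheory Filter

universe u v

/-- A probability-preserving action of the discrete semigroup `Γ` on a standard Borel
probability space. (There is no topology or measurable structure on `Γ`, and no cardinality
restriction.) -/
structure GammaSystem (Γ : Type v) [Semigroup Γ] where
  carrier : Type u
  [measurableSpace : MeasurableSpace carrier]
  [standardBorel : StandardBorelSpace carrier]
  [action : SemigroupAction Γ carrier]
  μ : Measure carrier
  [isProbabilityMeasure : IsProbabilityMeasure μ]
  measurePreserving_smul : ∀ γ : Γ, MeasurePreserving (fun x : carrier => γ • x) μ μ

namespace GammaSystem

variable {Γ : Type v} [Semigroup Γ]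

instance : CoeSort (GammaSystem.{u, v} Γ) (Type u) := ⟨GammaSystem.carrier⟩

attribute [instance] measurableSpace standardBorel action isProbabilityMeasure

/-- The trivial system(s): `μ` is supported on a single point. -/
def IsTrivial (X : GammaSystem.{u, v} Γ) : Prop :=
  ∃ x : X, X.μ = Measure.dirac x

/-- A factor map: a measurable, measure-preserving map that intertwines the actions almost
everywhere (for each element of `Γ`). -/
structure FactorMap (X Y : GammaSystem.{u, v} Γ) where
  toFun : X → Y
  measurePreserving : MeasurePreserving toFun X.μ Y.μ
  equivariant : ∀ γ : Γ, ∀ᵐ x ∂X.μ, toFun (γ • x) = γ • toFun x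

instance (X Y : GammaSystem.{u, v} Γ) : CoeFun (FactorMap X Y) (fun _ => X → Y) :=
  ⟨FactorMap.toFun⟩

/-- The factor `{π⁻¹(A)}` of the domain generated by a factor map `π`. -/
abbrev FactorMap.sigma {X Y : GammaSystem.{u, v} Γ} (π : FactorMap X Y) : MeasurableSpace X :=
  MeasurableSpace.comap π Y.measurableSpace

/-- `π` contains `ψ`: every set of `σ(ψ)` agrees with a set of `σ(π)` up to a null set. -/
def FactorMap.Contains {X Y Z : GammaSystem.{u, v} Γ} (π : FactorMap X Y) (ψ : FactorMap X Z) :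
    Prop :=
  ψ.sigma ≤ eventuallyMeasurableSpace π.sigma (ae X.μ)

/-- The σ-subalgebra `m` is the whole σ-algebra of `X`, up to null sets. -/
def GeneratesWhole (X : GammaSystem.{u, v} Γ) (m : MeasurableSpace X) : Prop :=
  X.measurableSpace ≤ eventuallyMeasurableSpace m (ae X.μ)

/-- Measure-theoretic isomorphism: a factor map that is invertible modulo null sets. -/
def IsIsomorphic (X Y : GammaSystem.{u, v} Γ) : Prop :=
  ∃ (f : FactorMap X Y) (g : FactorMap Y X),
    (∀ᵐ x ∂X.μ, g (f x) = x) ∧ (∀ᵐ y ∂Y.μ, f (g y) = y)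

/-- `X`, with the factor maps `π i`, is a joining of the systems `Y i`. -/
def IsJoining {k : ℕ} (Y : Fin k → GammaSystem.{u, v} Γ) (X : GammaSystem.{u, v} Γ)
    (π : ∀ i, FactorMap X (Y i)) : Prop :=
  X.GeneratesWhole (⨆ i, (π i).sigma)

/-- An inverse sequence of systems; `map h` is the connecting map `ψ^m_k` for `k ≤ m`. -/
structure InverseSequence (Γ : Type v) [Semigroup Γ] where
  sys : ℕ → GammaSystem.{u, v} Γ
  map : ∀ {k m : ℕ}, k ≤ m → FactorMap (sys m) (sys k)
  compat : ∀ {l k m : ℕ} (hlk : l ≤ k) (hkm : k ≤ m),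
    ∀ᵐ x ∂(sys m).μ, map hlk (map hkm x) = map (hlk.trans hkm) x

/-- `X`, with the factor maps `ψ m`, is an inverse limit of the inverse sequence `S`. -/
structure IsInverseLimit (S : InverseSequence.{u, v} Γ) (X : GammaSystem.{u, v} Γ)
    (ψ : ∀ m, FactorMap X (S.sys m)) : Prop where
  compat : ∀ {k m : ℕ} (h : k ≤ m), ∀ᵐ x ∂X.μ, S.map h (ψ m x) = ψ k x
  generates : X.GeneratesWhole (⨆ m, (ψ m).sigma)

/-- A class of `Γ`-systems is idempotent if it contains the trivial system and is closed under
isomorphism, inverse limits and joinings. -/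
structure IsIdempotent (C : Set (GammaSystem.{u, v} Γ)) : Prop where
  trivial_mem : ∀ X : GammaSystem.{u, v} Γ, X.IsTrivial → X ∈ C
  iso_mem : ∀ X Y : GammaSystem.{u, v} Γ, X.IsIsomorphic Y → X ∈ C → Y ∈ C
  inverseLimit_mem : ∀ (S : InverseSequence.{u, v} Γ) (X : GammaSystem.{u, v} Γ)
    (ψ : ∀ m, FactorMap X (S.sys m)), IsInverseLimit S X ψ → (∀ m, S.sys m ∈ C) → X ∈ C
  joining_mem : ∀ {k : ℕ} (Y : Fin k → GammaSystem.{u, v} Γ) (X : GammaSystem.{u, v} Γ)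
    (π : ∀ i, FactorMap X (Y i)), IsJoining Y X π → (∀ i, Y i ∈ C) → X ∈ C

/-- `ζ : X → Z` coordinatizes the maximal `C`-factor of `X`: its target is in `C`, and it
contains every factor map from `X` to a system in `C`. -/
structure IsMaximalFactor (C : Set (GammaSystem.{u, v} Γ)) {X Z : GammaSystem.{u, v} Γ}
    (ζ : FactorMap X Z) : Prop where
  mem : Z ∈ C
  contains : ∀ (Y : GammaSystem.{u, v} Γ) (ψ : FactorMap X Y), Y ∈ C → ζ.Contains ψ

/-- The tuple `(S 0, …, S (d-1))` of σ-subalgebras is relatively independent over the tuple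
`(Ξ 0, …, Ξ (d-1))`. -/
def RelIndep {X : Type u} [MeasurableSpace X] (μ : Measure X) {d : ℕ}
    (S Ξ : Fin d → MeasurableSpace X) : Prop :=
  ∀ f : Fin d → X → ℝ, (∀ i, StronglyMeasurable[S i] (f i)) → (∀ i, MemLp (f i) ⊤ μ) →
    ∫ x, ∏ i, f i x ∂μ = ∫ x, ∏ i, (μ[f i | Ξ i]) x ∂μ

/-- `X` is `C`-sated: for every extension `π : X' → X`, the factor maps `π` and `ζ'` are
relatively independent over `ζ ∘ π`, where `ζ'` and `ζ` coordinatize the maximal `C`-factors of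
`X'` and of `X`. These maximal factors are unique up to null sets, so that the choice of `ζ'` and
`ζ` does not matter; their existence is part of what is asserted here. -/
def IsSated (C : Set (GammaSystem.{u, v} Γ)) (X : GammaSystem.{u, v} Γ) : Prop :=
  ∀ (X' : GammaSystem.{u, v} Γ) (π : FactorMap X' X),
    ∃ (Z' Z : GammaSystem.{u, v} Γ) (ζ' : FactorMap X' Z') (ζ : FactorMap X Z),
      IsMaximalFactor C ζ' ∧ IsMaximalFactor C ζ ∧
      RelIndep X'.μ ![π.sigma, ζ'.sigma]
        (fun _ => MeasurableSpace.comap (fun x => ζ (π x)) Z.measurableSpace)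

end GammaSystem

/-! Satedness is the outcome of an energy-decrement argument. For a function `f` on `X`, its
deficiency, the `L²` distance to functions lifted from `C`-factors, can only drop when `f` is lifted
to an extension. Its infimum over all extensions, the lower deficiency, can only rise, since an
extension of an extension is an extension.

If the two agree for every bounded `f`, then `X` is sated (`isSated_of_deficiency_le`). In any
extension the projection of `f` to the lifted maximal `C`-factor of `X` is then already a best
approximation among functions measurable for the larger maximal `C`-factor. The error is therefore
orthogonal to all of these, which is relative independence.

To force equality, build a tower whose step `n` comes within `1/(n+1)` of the lower deficiency for
one class and one function, each pair recurring infinitely often (`exists_tower`). On the inverse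
limit (`exists_inverseLimit`) the two monotonicities squeeze the gap to zero for all functions of
the tower. These are `L²`-dense among bounded functions, and both quantities are 1-Lipschitz in
`L²`.

Each step can be taken to be a joining with a system in the class
(`exists_extension_deficiency_le`), so the limit is generated by `X₀` and its maximal factors. -/

section SigmaAlgebras

/-! ### Measurability modulo null sets -/

theorem exists_stronglyMeasurable_of_tendsto {Ω : Type*} {m : MeasurableSpace Ω}
    {k : ℕ → Ω → ℝ} (hk : ∀ n, StronglyMeasurable (k n)) :
    ∃ g : Ω → ℝ, StronglyMeasurable g ∧
      ∀ x a, Tendsto (fun n => k n x) atTop (nhds a) → g x = a :=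
  ⟨fun y ↦ limUnder atTop (k · y), StronglyMeasurable.limUnder hk, fun _ _ h => h.limUnder_eq⟩

variable {Ω : Type*} {m m' m0 : MeasurableSpace Ω} {μ : Measure Ω}

theorem comap_le_eventuallyMeasurableSpace_of_ae_eq {β : Type*} [MeasurableSpace β]
    {f g : Ω → β} (hg : Measurable[m] g) (h : f =ᵐ[μ] g) :
    MeasurableSpace.comap f inferInstance ≤ eventuallyMeasurableSpace m (ae μ) := by
  rintro _ ⟨s, hs, rfl⟩
  exact ⟨g ⁻¹' s, hg hs, h.preimage s⟩

theorem eventuallyMeasurableSpace_le_of_le (h : m ≤ eventuallyMeasurableSpace m' (ae μ)) :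
    eventuallyMeasurableSpace m (ae μ) ≤ eventuallyMeasurableSpace m' (ae μ) := by
  rintro s ⟨t, ht, hst⟩
  obtain ⟨r, hr, htr⟩ := h t ht
  exact ⟨r, hr, hst.trans htr⟩

theorem MeasureTheory.StronglyMeasurable.aestronglyMeasurable_of_le_eventuallyMeasurableSpace
    {f : Ω → ℝ} (hf : StronglyMeasurable[m] f) (h : m ≤ eventuallyMeasurableSpace m' (ae μ)) :
    AEStronglyMeasurable[m'] f μ := by
  classical
  induction f, hf using StronglyMeasurable.induction' with
  | const z => exact ⟨fun _ ↦ z, stronglyMeasurable_const, ae_eq_rfl⟩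
  | @pcw g₁ g₂ s hg₁ hg₂ hs h₁ h₂ =>
    obtain ⟨t, ht, hst⟩ := h s hs
    obtain ⟨k₁, mk₁, e₁⟩ := h₁
    obtain ⟨k₂, mk₂, e₂⟩ := h₂
    refine ⟨t.piecewise k₁ k₂, mk₁.piecewise ht mk₂, ?_⟩
    filter_upwards [hst.mem_iff, e₁, e₂] with x hx h1 h2
    by_cases hxs : x ∈ s
    · rw [Set.piecewise_eq_of_mem _ _ _ hxs, Set.piecewise_eq_of_mem _ _ _ (hx.1 hxs), h1]
    · rw [Set.piecewise_eq_of_notMem _ _ _ hxs,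
        Set.piecewise_eq_of_notMem _ _ _ (fun ht => hxs (hx.2 ht)), h2]
  | @lim g i hg hi h₁ h₂ =>
    choose k mk hk using h₁
    obtain ⟨k', mk', hk'⟩ := exists_stronglyMeasurable_of_tendsto mk
    refine ⟨k', mk', ?_⟩
    filter_upwards [ae_all_iff.2 hk] with x hx
    refine (hk' x _ ?_).symm
    simpa [hx] using h₂ x

theorem exists_ae_eq_comp_of_aestronglyMeasurable_comap {β : Type*} [mβ : MeasurableSpace β]
    {ψ : Ω → β} {f : Ω → ℝ} (hf : AEStronglyMeasurable[mβ.comap ψ] f μ) :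
    ∃ h : β → ℝ, StronglyMeasurable h ∧ f =ᵐ[μ] h ∘ ψ := by
  obtain ⟨g, hg, hfg⟩ := hf
  obtain ⟨h, hh, rfl⟩ := hg.exists_eq_measurable_comp
  exact ⟨h, hh, hfg⟩

end SigmaAlgebras

/-! ### Conditional expectation as `L²` projection -/

section Projection

/-- First variation: expanding the square gives a quadratic in `t` that is nonnegative and has
constant term zero, so its discriminant `4⟨v, g⟩²` vanishes. -/
theorem integral_mul_eq_zero_of_eLpNorm_le {Ω : Type*} {m0 : MeasurableSpace Ω}
    {μ : Measure Ω} {v g : Ω → ℝ} (hv : MemLp v 2 μ) (hg : MemLp g 2 μ)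
    (h : ∀ t : ℝ, eLpNorm v 2 μ ≤ eLpNorm (v - t • g) 2 μ) : ∫ x, v x * g x ∂μ = 0 := by
  have hin : inner ℝ (hv.toLp v) (hg.toLp g) = ∫ x, v x * g x ∂μ := by
    rw [L2.inner_def]
    refine integral_congr_ae ?_
    filter_upwards [hv.coeFn_toLp, hg.coeFn_toLp] with x h1 h2
    simp [h1, h2, mul_comm]
  rw [← hin]
  set V := hv.toLp v
  set W := hg.toLp g
  have key : ∀ t : ℝ, ‖V‖ ≤ ‖V - t • W‖ := by
    intro t
    have : V - t • W = (hv.sub (hg.const_smul t)).toLp (v - t • g) := by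
      rw [MemLp.toLp_sub hv (hg.const_smul t), MemLp.toLp_const_smul]
    rw [this, Lp.norm_toLp, Lp.norm_toLp]
    exact ENNReal.toReal_mono (hv.sub (hg.const_smul t)).2.ne (h t)
  have key2 : ∀ t : ℝ, 0 ≤ (‖W‖ ^ 2) * (t * t) + (-2 * inner ℝ V W) * t + 0 := by
    intro t
    have h1 := pow_le_pow_left₀ (norm_nonneg _) (key t) 2
    rw [norm_sub_sq_real, norm_smul, inner_smul_right, mul_pow, Real.norm_eq_abs, sq_abs] at h1
    linarith
  have := discrim_le_zero key2
  rw [discrim] at this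
  nlinarith

variable {Ω : Type*} {m m0 : MeasurableSpace Ω} {μ : Measure Ω} [IsProbabilityMeasure μ]

/-- The conditional expectation is the orthogonal projection onto `L²(m)`. A competitor `G` outside
`L²` is at infinite distance, so it need not be excluded. -/
theorem eLpNorm_sub_condExp_le (hm : m ≤ m0) {F G : Ω → ℝ}
    (hF : MemLp F 2 μ) (hG : AEStronglyMeasurable[m] G μ) :
    eLpNorm (F - μ[F | m]) 2 μ ≤ eLpNorm (F - G) 2 μ := by
  by_cases hFG : MemLp (F - G) 2 μ
  · have hG2 : MemLp G 2 μ := by simpa using hF.sub hFG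
    have : Fact (m ≤ m0) := ⟨hm⟩
    have hE := MemLp.condExpL2_ae_eq_condExp (𝕜 := ℝ) hm hF
    let U := lpMeas ℝ ℝ m 2 μ
    let g : U := ⟨hG2.toLp G, (mem_lpMeas_iff_aestronglyMeasurable).2 (hG.congr
      hG2.coeFn_toLp.symm)⟩
    have key : ‖hF.toLp F - (condExpL2 ℝ ℝ hm (hF.toLp F) : Lp ℝ 2 μ)‖
        ≤ ‖hF.toLp F - (g : Lp ℝ 2 μ)‖ := by
      have := Submodule.starProjection_minimal (U := U) (hF.toLp F)
      change ‖hF.toLp F - U.starProjection (hF.toLp F)‖ ≤ _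
      rw [this]
      exact ciInf_le ⟨0, by rintro _ ⟨x, rfl⟩; positivity⟩ g
    rw [Lp.norm_def, Lp.norm_def, ENNReal.toReal_le_toReal (Lp.eLpNorm_ne_top _)
      (Lp.eLpNorm_ne_top _)] at key
    refine le_trans (le_of_eq (eLpNorm_congr_ae ?_)) (key.trans (le_of_eq (eLpNorm_congr_ae ?_)))
    · filter_upwards [Lp.coeFn_sub (hF.toLp F) (condExpL2 ℝ ℝ hm (hF.toLp F) : Lp ℝ 2 μ), hE,
        hF.coeFn_toLp] with x h1 h2 h3
      rw [h1, Pi.sub_apply, Pi.sub_apply, h2, h3]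
    · filter_upwards [Lp.coeFn_sub (hF.toLp F) (g : Lp ℝ 2 μ), hG2.coeFn_toLp,
        hF.coeFn_toLp] with x h1 h2 h3
      rw [h1, Pi.sub_apply, Pi.sub_apply, h3, h2]
  · have hns : AEStronglyMeasurable (F - G) μ := hF.1.sub (hG.mono hm)
    have : eLpNorm (F - G) 2 μ = ⊤ := by
      by_contra hne
      exact hFG ⟨hns, lt_top_iff_ne_top.2 hne⟩
    rw [this]; exact le_top

/-- Lévy's upward theorem gives convergence in `L¹`; the uniform bound `2R` on the difference
upgrades it through `‖u‖₂² ≤ 2R ‖u‖₁`. -/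
theorem exists_eLpNorm_sub_condExp_le (ℱ : Filtration ℕ m0) (hℱ : m0 ≤ ⨆ n, ℱ n)
    {f : Ω → ℝ} (hf : Measurable f) (hb : MemLp f ⊤ μ) {ε : ENNReal} (hε : ε ≠ 0) :
    ∃ n, eLpNorm (f - μ[f | ℱ n]) 2 μ ≤ ε := by
  obtain ⟨R, hR⟩ : ∃ R : NNReal, ∀ᵐ x ∂μ, |f x| ≤ R := by
    refine ⟨(eLpNorm f ⊤ μ).toNNReal, ?_⟩
    filter_upwards [ae_le_eLpNormEssSup (f := f) (μ := μ)] with x hx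
    rw [← Real.norm_eq_abs, ← coe_nnnorm, NNReal.coe_le_coe, ← ENNReal.coe_le_coe,
      ENNReal.coe_toNNReal hb.2.ne, eLpNorm_exponent_top]
    exact hx
  have hint : Integrable f μ := hb.integrable le_top
  have hL1 := hint.tendsto_eLpNorm_condExp (ℱ := ℱ) (hf.stronglyMeasurable.mono hℱ)
  have hbd : ∀ n, ∀ᵐ x ∂μ, ‖(μ[f | ℱ n] - f) x‖ₑ ≤ (2 * R : NNReal) := by
    intro n
    filter_upwards [hR, ae_bdd_abs_condExp_of_ae_bdd_abs (m := ℱ n) hR] with x h1 h2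
    rw [enorm_eq_nnnorm, ENNReal.coe_le_coe, ← NNReal.coe_le_coe, coe_nnnorm, Pi.sub_apply]
    have := norm_sub_le (μ[f | ℱ n] x) (f x)
    simp only [Real.norm_eq_abs] at *
    push_cast
    linarith
  have hle : ∀ n, eLpNorm (μ[f | ℱ n] - f) 2 μ
      ≤ (((2 * R : NNReal) : ENNReal) * eLpNorm (μ[f | ℱ n] - f) 1 μ) ^ (1 / 2 : ℝ) := by
    intro n
    rw [eLpNorm_eq_lintegral_rpow_enorm_toReal (by simp) (by simp), eLpNorm_one_eq_lintegral_enorm]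
    simp only [ENNReal.toReal_ofNat]
    refine ENNReal.rpow_le_rpow ?_ (by norm_num)
    rw [← lintegral_const_mul' _ _ ENNReal.coe_ne_top]
    refine lintegral_mono_ae ?_
    filter_upwards [hbd n] with x hx
    rw [ENNReal.rpow_ofNat, sq]
    gcongr
  have hlim : Tendsto (fun n => eLpNorm (μ[f | ℱ n] - f) 2 μ) atTop (nhds 0) := by
    refine tendsto_of_tendsto_of_tendsto_of_le_of_le tendsto_const_nhds ?_ (fun _ => zero_le) hle
    have h1 := ENNReal.Tendsto.const_mul (a := ((2 * R : NNReal) : ENNReal)) hL1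
      (Or.inr ENNReal.coe_ne_top)
    have h2 := (ENNReal.continuous_rpow_const (y := (1 / 2 : ℝ))).tendsto _ |>.comp h1
    simpa [Function.comp_def] using h2
  obtain ⟨n, hn⟩ := (hlim.eventually (ge_mem_nhds (pos_iff_ne_zero.2 hε))).exists
  refine ⟨n, ?_⟩
  rwa [eLpNorm_sub_comm]

end Projection

/-! ### Factor maps and joint laws -/

namespace GammaSystem

variable {Γ : Type v} [Semigroup Γ]

/-- The identity factor map. -/
def FactorMap.id (X : GammaSystem.{u, v} Γ) : FactorMap X X :=
  ⟨fun x => x, MeasurePreserving.id _, fun _ => .of_forall fun _ => rfl⟩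

/-- Composition of factor maps. -/
def FactorMap.comp {X Y Z : GammaSystem.{u, v} Γ} (ψ : FactorMap Y Z) (π : FactorMap X Y) :
    FactorMap X Z where
  toFun x := ψ (π x)
  measurePreserving := ψ.measurePreserving.comp π.measurePreserving
  equivariant γ := by
    filter_upwards [π.equivariant γ,
      π.measurePreserving.quasiMeasurePreserving.ae (ψ.equivariant γ)] with x h1 h2
    rw [h1, h2]

theorem FactorMap.measurable {X Y : GammaSystem.{u, v} Γ} (π : FactorMap X Y) : Measurable π :=
  π.measurePreserving.measurable

theorem FactorMap.sigma_le {X Y : GammaSystem.{u, v} Γ} (π : FactorMap X Y) :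
    π.sigma ≤ X.measurableSpace :=
  π.measurable.comap_le

theorem FactorMap.ae {X Y : GammaSystem.{u, v} Γ} (π : FactorMap X Y) {P : Y → Prop}
    (h : ∀ᵐ y ∂Y.μ, P y) : ∀ᵐ x ∂X.μ, P (π x) :=
  π.measurePreserving.quasiMeasurePreserving.ae h

theorem measurable_smul (X : GammaSystem.{u, v} Γ) (γ : Γ) : Measurable fun x : X => γ • x :=
  (X.measurePreserving_smul γ).measurable

section Joint

variable {J : Type} [Countable J]

/-- The coordinatewise action on a product. -/
abbrev piAction (Y : J → GammaSystem.{u, v} Γ) : SemigroupAction Γ (∀ j, Y j) where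
  smul γ y := fun j => γ • y j
  mul_smul γ γ' y := funext fun j => mul_smul γ γ' (y j)

/-- The product of the `Y j` with the coordinatewise action and an invariant measure. -/
def ofPi (Y : J → GammaSystem.{u, v} Γ) (μ : Measure (∀ j, Y j)) [IsProbabilityMeasure μ]
    (h : ∀ γ : Γ, μ.map (fun (y : ∀ j, Y j) j => γ • y j) = μ) : GammaSystem.{u, v} Γ where
  carrier := ∀ j, Y j
  action := piAction Y
  μ := μ
  measurePreserving_smul γ :=
    ⟨measurable_pi_lambda _ fun j => ((Y j).measurable_smul γ).comp (measurable_pi_apply j), h γ⟩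

variable {X : GammaSystem.{u, v} Γ} (Y : J → GammaSystem.{u, v} Γ) (ψ : ∀ j, FactorMap X (Y j))

theorem measurable_jointFun {J : Type} {X : GammaSystem.{u, v} Γ} (Y : J → GammaSystem.{u, v} Γ)
    (ψ : ∀ j, FactorMap X (Y j)) : Measurable fun x j => ψ j x :=
  measurable_pi_lambda _ fun j => (ψ j).measurable

/-- The joining of the `Y j` that is given by the joint law of factor maps `ψ j` on `X`. -/
noncomputable def joint : GammaSystem.{u, v} Γ :=
  haveI : IsProbabilityMeasure (X.μ.map fun x j => ψ j x) :=
    Measure.isProbabilityMeasure_map (measurable_jointFun Y ψ).aemeasurable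
  ofPi Y (X.μ.map fun x j => ψ j x) fun γ => by
    have hm := measurable_jointFun Y ψ
    have h1 : Measurable (fun (y : ∀ j, Y j) j => γ • y j) :=
      measurable_pi_lambda _ fun j => ((Y j).measurable_smul γ).comp (measurable_pi_apply j)
    rw [Measure.map_map h1 hm]
    conv_rhs => rw [← (X.measurePreserving_smul γ).map_eq]
    rw [Measure.map_map hm (X.measurable_smul γ)]
    refine Measure.map_congr ?_
    filter_upwards [ae_all_iff.2 fun j => (ψ j).equivariant γ] with x hx
    exact funext fun j => (hx j).symm

/-- The factor map from `X` to the joint law of the `ψ j`. -/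
noncomputable def jointMap : FactorMap X (joint Y ψ) where
  toFun x := fun j => ψ j x
  measurePreserving := ⟨measurable_jointFun Y ψ, rfl⟩
  equivariant γ := by
    filter_upwards [ae_all_iff.2 fun j => (ψ j).equivariant γ] with x hx
    exact funext hx

/-- The coordinate projections of a joint law. -/
noncomputable def jointProj (j : J) : FactorMap (joint Y ψ) (Y j) where
  toFun y := y j
  measurePreserving := ⟨measurable_pi_apply j, by
    change (X.μ.map fun x j => ψ j x).map (fun y => y j) = _
    rw [Measure.map_map (measurable_pi_apply j) (measurable_jointFun Y ψ)]
    exact (ψ j).measurePreserving.map_eq⟩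
  equivariant _ := .of_forall fun _ => rfl

theorem joint_measurableSpace : (joint Y ψ).measurableSpace = ⨆ j, (jointProj Y ψ j).sigma := rfl

theorem sigma_le_sigma_jointMap (j : J) : (ψ j).sigma ≤ (jointMap Y ψ).sigma := by
  rintro _ ⟨s, hs, rfl⟩
  exact ⟨jointProj Y ψ j ⁻¹' s, (jointProj Y ψ j).measurable hs, rfl⟩

/-- The restriction of a joint law to fewer coordinates. -/
noncomputable def jointRestrict {K : Type} [Countable K] (e : K → J) :
    FactorMap (joint Y ψ) (joint (fun k => Y (e k)) fun k => ψ (e k)) where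
  toFun y := fun k => y (e k)
  measurePreserving := by
    have hm : Measurable fun (y : ∀ j, Y j) k => y (e k) :=
      measurable_pi_lambda _ fun k => measurable_pi_apply _
    refine ⟨hm, ?_⟩
    change (X.μ.map fun x j => ψ j x).map (fun y k => y (e k)) = _
    rw [Measure.map_map hm (measurable_jointFun Y ψ)]
    rfl
  equivariant _ := .of_forall fun _ => rfl

end Joint

/-! ### Existence of maximal factors -/

theorem generatesWhole_of_le {X : GammaSystem.{u, v} Γ} {m : MeasurableSpace X}
    (h : X.measurableSpace ≤ m) : X.GeneratesWhole m :=
  h.trans le_eventuallyMeasurableSpace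

/-- A countable joining is the inverse limit of the joinings of its first `n` coordinates. -/
theorem IsIdempotent.joint_mem {C : Set (GammaSystem.{u, v} Γ)} (hC : IsIdempotent C)
    {X : GammaSystem.{u, v} Γ} (Y : ℕ → GammaSystem.{u, v} Γ) (ψ : ∀ n, FactorMap X (Y n))
    (hY : ∀ n, Y n ∈ C) : joint Y ψ ∈ C := by
  let S : InverseSequence.{u, v} Γ :=
    { sys := fun n => joint (fun i : Fin n => Y i) fun i => ψ i
      map := fun {k m} h => jointRestrict (fun i : Fin m => Y i) (fun i => ψ i) (Fin.castLE h)
      compat := fun _ _ => .of_forall fun _ => rfl }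
  refine hC.inverseLimit_mem S (joint Y ψ) (fun n => jointRestrict Y ψ fun i : Fin n => (i : ℕ))
    ⟨fun _ => .of_forall fun _ => rfl, generatesWhole_of_le ?_⟩ fun n => ?_
  · rw [joint_measurableSpace]
    refine iSup_le fun j => le_trans ?_ (le_iSup _ (j + 1))
    rintro _ ⟨s, hs, rfl⟩
    exact ⟨jointProj (fun i : Fin (j + 1) => Y i) (fun i => ψ i) (Fin.last j) ⁻¹' s,
      (jointProj (fun i : Fin (j + 1) => Y i) (fun i => ψ i) (Fin.last j)).measurable hs, rfl⟩
  · exact hC.joining_mem _ _ (jointProj (fun i : Fin n => Y i) fun i => ψ i)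
      (generatesWhole_of_le (joint_measurableSpace _ _).le) fun i => hY i

/-- The empty joining is a one-point system, and every system maps to it. -/
theorem IsIdempotent.exists_factorMap {C : Set (GammaSystem.{u, v} Γ)} (hC : IsIdempotent C)
    (X : GammaSystem.{u, v} Γ) : ∃ Y ∈ C, Nonempty (FactorMap X Y) := by
  let Y : Fin 0 → GammaSystem.{u, v} Γ := fun _ => X
  let ψ : ∀ i : Fin 0, FactorMap X (Y i) := fun i => i.elim0
  exact ⟨joint Y ψ, hC.joining_mem Y _ (jointProj Y ψ)
    (generatesWhole_of_le (joint_measurableSpace _ _).le) fun i => i.elim0, ⟨jointMap Y ψ⟩⟩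

/-- `L²` is separable, so countably many `C`-factors already carry a dense subset of all `L²`
functions measurable for some `C`-factor. Their joint law is in `C`, and measurability for it is a
closed condition in `L²`, so it captures every such function, in particular indicators. -/
theorem IsIdempotent.exists_isMaximalFactor {C : Set (GammaSystem.{u, v} Γ)}
    (hC : IsIdempotent C) (X : GammaSystem.{u, v} Γ) :
    ∃ (Z : GammaSystem.{u, v} Γ) (ζ : FactorMap X Z), IsMaximalFactor C ζ := by
  let S : Set (Lp ℝ 2 X.μ) := {F | ∃ Y ∈ C, ∃ ψ : FactorMap X Y, AEStronglyMeasurable[ψ.sigma] F X.μ}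
  have : Nonempty S := by
    obtain ⟨Y, hY, ⟨ψ⟩⟩ := hC.exists_factorMap X
    exact ⟨⟨0, Y, hY, ψ, ⟨0, stronglyMeasurable_zero, Lp.coeFn_zero _ _ _⟩⟩⟩
  have : Fact ((1 : ENNReal) ≤ 2) := ⟨one_le_two⟩
  have : Fact ((2 : ENNReal) ≠ ⊤) := ⟨by simp⟩
  have hF : ∀ n, (TopologicalSpace.denseSeq S n : Lp ℝ 2 X.μ) ∈ S := fun n => Subtype.coe_prop _
  choose Y hY ψ hψ using hF
  refine ⟨joint Y ψ, jointMap Y ψ, hC.joint_mem Y ψ hY, fun Z φ hZ A hA => ?_⟩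
  have hle : (jointMap Y ψ).sigma ≤ X.measurableSpace := (jointMap Y ψ).sigma_le
  have hA' : MeasurableSet A := φ.sigma_le A hA
  have hclosed : IsClosed {F : Lp ℝ 2 X.μ | AEStronglyMeasurable[(jointMap Y ψ).sigma] F X.μ} :=
    isClosed_aestronglyMeasurable hle
  have hsub : S ⊆ {F : Lp ℝ 2 X.μ | AEStronglyMeasurable[(jointMap Y ψ).sigma] F X.μ} := by
    intro F hFS
    have h1 : (⟨F, hFS⟩ : S) ∈ closure (Set.range (TopologicalSpace.denseSeq S)) :=
      TopologicalSpace.denseRange_denseSeq S _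
    have h2 := (closure_subtype (x := (⟨F, hFS⟩ : S))).1 h1
    refine hclosed.closure_subset_iff.2 ?_ h2
    rintro _ ⟨_, ⟨n, rfl⟩, rfl⟩
    obtain ⟨g, hg, hfg⟩ := hψ n
    exact ⟨g, hg.mono (sigma_le_sigma_jointMap Y ψ n), hfg⟩
  have hmem : indicatorConstLp 2 hA' (measure_ne_top X.μ A) (1 : ℝ) ∈ S :=
    ⟨Z, hZ, φ, ⟨A.indicator fun _ => 1, stronglyMeasurable_const.indicator hA,
      indicatorConstLp_coeFn⟩⟩
  obtain ⟨g, hg, hfg⟩ := hsub hmem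
  -- `g` is a version of the indicator of `A`, so this level set recovers `A` up to a null set.
  refine ⟨g ⁻¹' {1}, hg.measurable (measurableSet_singleton 1), ?_⟩
  refine eventuallyEq_set.2 ?_
  filter_upwards [hfg, indicatorConstLp_coeFn (hs := hA') (hμs := measure_ne_top X.μ A)
    (c := (1 : ℝ)) (p := 2)] with x h1 h2
  rw [h2] at h1
  rw [Set.mem_preimage, ← h1]
  by_cases hx : x ∈ A <;> simp [hx]

end GammaSystem

/-! ### Inverse limits -/

namespace GammaSystem

variable {Γ : Type v} [Semigroup Γ]

open ProbabilityTheory in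
-- Ionescu-Tulcea: run the Markov chain that chooses the next coordinate by disintegrating `μ (n +
-- 1)` over `p n`. Consecutive coordinates then have the law of `(p n y, y)`, which gives both the
-- marginals and the compatibility.
theorem exists_measure_of_sequence (E : ℕ → Type u) [∀ n, MeasurableSpace (E n)]
    [∀ n, StandardBorelSpace (E n)] (μ : ∀ n, Measure (E n)) [∀ n, IsProbabilityMeasure (μ n)]
    (p : ∀ n, E (n + 1) → E n) (hp : ∀ n, MeasurePreserving (p n) (μ (n + 1)) (μ n)) :
    ∃ L : Measure (∀ n, E n), IsProbabilityMeasure L ∧ (∀ n, L.map (fun x => x n) = μ n) ∧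
      ∀ n, ∀ᵐ x ∂L, p n (x (n + 1)) = x n := by
  have hne : ∀ n, Nonempty (E n) := fun n => (μ n).nonempty_of_neZero
  let κ : ∀ n, Kernel (∀ i : Finset.Iic n, E i) (E (n + 1)) := fun n =>
    (condDistrib id (p n) (μ (n + 1))).comap (fun x => x ⟨n, Finset.mem_Iic.2 le_rfl⟩)
      (measurable_pi_apply _)
  let L := Kernel.trajMeasure (μ 0) κ
  have h0 : L.map (fun x => x 0) = μ 0 := by
    let e : E 0 → ∀ i : Finset.Iic 0, E i :=
      (MeasurableEquiv.piUnique fun i : Finset.Iic 0 => E i).symm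
    have he : Measurable e := (MeasurableEquiv.piUnique fun i : Finset.Iic 0 => E i).symm.measurable
    have h1 : L.map (Preorder.frestrictLe 0) = (μ 0).map e := by
      change Measure.map _ (Kernel.traj κ 0 ∘ₘ _) = _
      rw [Measure.map_comp _ _ (by fun_prop), Kernel.traj_map_frestrictLe,
        Kernel.partialTraj_self, Measure.id_comp]
      rfl
    have h2 := congrArg (Measure.map fun x : ∀ i : Finset.Iic 0, E i =>
      x ⟨0, Finset.mem_Iic.2 le_rfl⟩) h1
    rw [Measure.map_map (by fun_prop) (by fun_prop), Measure.map_map (by fun_prop)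
      he] at h2
    refine Eq.trans h2 ?_
    exact Measure.map_id
  have hpair : ∀ n, L.map (fun x => x n) = μ n →
      L.map (fun x => (x n, x (n + 1))) = (μ (n + 1)).map fun y => (p n y, y) := by
    intro n hn
    have h1 := Kernel.map_frestrictLe_trajMeasure_compProd_eq_map_trajMeasure (μ₀ := μ 0)
      (κ := κ) (a := n)
    have h2 := congrArg (Measure.map (Prod.map (fun x : ∀ i : Finset.Iic n, E i =>
      x ⟨n, Finset.mem_Iic.2 le_rfl⟩) id)) h1
    rw [Measure.map_map (by fun_prop) (by fun_prop)] at h2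
    refine h2.symm.trans ?_
    have h3 := compProd_map_condDistrib (mβ := inferInstance) (X := p n) (μ := μ (n + 1))
      (Y := id) measurable_id.aemeasurable
    refine Eq.trans ?_ h3
    rw [(hp n).map_eq, ← hn]
    ext s hs
    rw [Measure.map_apply (by fun_prop) hs, Measure.compProd_apply (by measurability),
      Measure.compProd_apply hs, lintegral_map (Kernel.measurable_kernel_prodMk_left hs)
        (by fun_prop), lintegral_map (Kernel.measurable_kernel_prodMk_left
          (by measurability)) (by fun_prop)]
    rfl
  have hpm : ∀ n, Measurable fun y => (p n y, y) := fun n =>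
    (hp n).measurable.prodMk measurable_id
  have hmarg : ∀ n, L.map (fun x => x n) = μ n := by
    intro n
    induction n with
    | zero => exact h0
    | succ n ih =>
      have := congrArg (Measure.map Prod.snd) (hpair n ih)
      rw [Measure.map_map (by fun_prop) (by fun_prop), Measure.map_map (by fun_prop)
        (hpm n)] at this
      simpa [Function.comp_def] using this
  refine ⟨L, inferInstance, hmarg, fun n => ?_⟩
  have hset : MeasurableSet {z : E n × E (n + 1) | p n z.2 = z.1} :=
    measurableSet_eq_fun ((hp n).measurable.comp measurable_snd) measurable_fst
  have h3 : ∀ᵐ z ∂(L.map fun x => (x n, x (n + 1))), p n z.2 = z.1 := by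
    rw [hpair n (hmarg n), ae_map_iff (hpm n).aemeasurable hset]
    exact .of_forall fun _ => rfl
  exact ae_of_ae_map (by fun_prop) h3

theorem exists_inverseLimit (sys : ℕ → GammaSystem.{u, v} Γ)
    (p : ∀ n, FactorMap (sys (n + 1)) (sys n)) :
    ∃ (X : GammaSystem.{u, v} Γ) (q : ∀ n, FactorMap X (sys n)),
      (∀ n, ∀ᵐ x ∂X.μ, p n (q (n + 1) x) = q n x) ∧ X.measurableSpace ≤ ⨆ n, (q n).sigma := by
  obtain ⟨L, hL, hmarg, hcompat⟩ := exists_measure_of_sequence (fun n => (sys n).carrier)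
    (fun n => (sys n).μ) (fun n => p n) fun n => (p n).measurePreserving
  have hmp : ∀ n, MeasurePreserving (fun x : ∀ n, sys n => x n) L (sys n).μ := fun n =>
    ⟨measurable_pi_apply n, hmarg n⟩
  have hchain : ∀ i n, i ≤ n →
      ∃ c : FactorMap (sys n) (sys i), ∀ᵐ x ∂L, c (x n) = x i := by
    intro i n hin
    induction n, hin using Nat.le_induction with
    | base => exact ⟨FactorMap.id _, .of_forall fun _ => rfl⟩
    | succ n hn ih =>
      obtain ⟨c, hc⟩ := ih
      refine ⟨c.comp (p n), ?_⟩
      filter_upwards [hc, hcompat n] with x h1 h2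
      change c (p n (x (n + 1))) = x i
      rw [h2, h1]
  choose c hc using hchain
  have hinv : ∀ γ : Γ, L.map (fun (x : ∀ n, sys n) n => γ • x n) = L := by
    intro γ
    have hm : Measurable (fun (x : ∀ n, sys n) n => γ • x n) :=
      measurable_pi_lambda _ fun j => ((sys j).measurable_smul γ).comp (measurable_pi_apply j)
    conv_rhs => rw [← Measure.map_id (μ := L)]
    -- Finite-dimensional laws suffice. Any finitely many coordinates are almost everywhere an
    -- equivariant function of a single later coordinate, whose law is invariant.
    refine (ProbabilityTheory.map_eq_iff_forall_finset_map_restrict_eq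
      (X := fun n (x : ∀ n, sys n) => γ • x n) (Y := fun n (x : ∀ n, sys n) => x n)
      hm.aemeasurable aemeasurable_id).2 fun I => ?_
    let N := I.sup id
    have hN : ∀ i : I, (i : ℕ) ≤ N := fun i => Finset.le_sup (f := id) i.2
    let k : sys N → ∀ i : I, sys i := fun y i => c i N (hN i) y
    have hk : Measurable k := measurable_pi_lambda _ fun i => (c i N (hN i)).measurable
    have h1 : (fun (x : ∀ n, sys n) => I.restrict fun n => x n) =ᵐ[L] k ∘ fun x => x N := by
      filter_upwards [ae_all_iff.2 fun i : I => hc i N (hN i)] with x hx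
      exact funext fun i => (hx i).symm
    have h2 : (fun (x : ∀ n, sys n) => I.restrict fun n => γ • x n) =ᵐ[L]
        (k ∘ fun y => γ • y) ∘ fun x => x N := by
      filter_upwards [ae_all_iff.2 fun i : I => hc i N (hN i),
        (hmp N).quasiMeasurePreserving.ae
          (ae_all_iff.2 fun i : I => (c i N (hN i)).equivariant γ)] with x hx hx'
      refine funext fun i => ?_
      change γ • x i = c i N (hN i) (γ • x N)
      rw [hx' i, hx i]
    rw [Measure.map_congr h1, Measure.map_congr h2,
      ← Measure.map_map (hk.comp ((sys N).measurable_smul γ)) (hmp N).measurable,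
      ← Measure.map_map hk (hmp N).measurable, (hmp N).map_eq,
      ← Measure.map_map hk ((sys N).measurable_smul γ), ((sys N).measurePreserving_smul γ).map_eq]
  refine ⟨ofPi sys L hinv, fun n => ⟨fun x => x n, hmp n, fun _ => .of_forall fun _ => rfl⟩,
    hcompat, le_rfl⟩

end GammaSystem

/-! ### Deficiency and satedness -/

namespace GammaSystem

variable {Γ : Type v} [Semigroup Γ] {C : Set (GammaSystem.{u, v} Γ)}

theorem FactorMap.eLpNorm_comp {X Y : GammaSystem.{u, v} Γ} (π : FactorMap X Y) {f : Y → ℝ}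
    (hf : AEStronglyMeasurable f Y.μ) (p : ENNReal) :
    eLpNorm (f ∘ π) p X.μ = eLpNorm f p Y.μ :=
  eLpNorm_comp_measurePreserving hf π.measurePreserving

theorem FactorMap.aestronglyMeasurable_comp {X Y : GammaSystem.{u, v} Γ} (π : FactorMap X Y)
    {f : Y → ℝ} (hf : AEStronglyMeasurable f Y.μ) : AEStronglyMeasurable (f ∘ π) X.μ :=
  hf.comp_measurePreserving π.measurePreserving

/-- The `L²`-distance of `f` from the functions that are lifted from factors of `X` in `C`. -/
noncomputable def deficiency (C : Set (GammaSystem.{u, v} Γ)) (X : GammaSystem.{u, v} Γ)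
    (f : X → ℝ) : ENNReal :=
  ⨅ (Y : GammaSystem.{u, v} Γ) (_ : Y ∈ C) (ψ : FactorMap X Y) (h : Y → ℝ)
    (_ : AEStronglyMeasurable h Y.μ), eLpNorm (f - h ∘ ψ) 2 X.μ

/-- The infimum of the deficiencies of the lifts of `f` to the extensions of `X`. -/
noncomputable def lowerDeficiency (C : Set (GammaSystem.{u, v} Γ)) (X : GammaSystem.{u, v} Γ)
    (f : X → ℝ) : ENNReal :=
  ⨅ (X' : GammaSystem.{u, v} Γ) (π : FactorMap X' X), deficiency C X' (f ∘ π)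

theorem deficiency_le {X Y : GammaSystem.{u, v} Γ} (hY : Y ∈ C) (ψ : FactorMap X Y)
    (f : X → ℝ) {h : Y → ℝ} (hh : AEStronglyMeasurable h Y.μ) :
    deficiency C X f ≤ eLpNorm (f - h ∘ ψ) 2 X.μ :=
  iInf_le_of_le Y <| iInf_le_of_le hY <| iInf_le_of_le ψ <| iInf_le_of_le h <| iInf_le _ hh

theorem le_deficiency {X : GammaSystem.{u, v} Γ} {f : X → ℝ} {a : ENNReal}
    (hle : ∀ Y ∈ C, ∀ (ψ : FactorMap X Y) (k : Y → ℝ), AEStronglyMeasurable k Y.μ →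
      a ≤ eLpNorm (f - k ∘ ψ) 2 X.μ) : a ≤ deficiency C X f :=
  le_iInf fun Y => le_iInf fun hY => le_iInf fun ψ => le_iInf fun k => le_iInf fun hk =>
    hle Y hY ψ k hk

theorem deficiency_comp_le {X X' : GammaSystem.{u, v} Γ} (π : FactorMap X' X) {f : X → ℝ}
    (hf : AEStronglyMeasurable f X.μ) : deficiency C X' (f ∘ π) ≤ deficiency C X f :=
  le_deficiency fun _ hY ψ _ hh => (deficiency_le hY (ψ.comp π) (f ∘ π) hh).trans
    (π.eLpNorm_comp (hf.sub (ψ.aestronglyMeasurable_comp hh)) 2).le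

theorem lowerDeficiency_le {X X' : GammaSystem.{u, v} Γ} (π : FactorMap X' X) (f : X → ℝ) :
    lowerDeficiency C X f ≤ deficiency C X' (f ∘ π) :=
  iInf_le_of_le X' <| iInf_le _ π

theorem lowerDeficiency_le_comp {X X' : GammaSystem.{u, v} Γ} (π : FactorMap X' X) (f : X → ℝ) :
    lowerDeficiency C X f ≤ lowerDeficiency C X' (f ∘ π) :=
  le_iInf fun _ => le_iInf fun π' => lowerDeficiency_le (π.comp π') f

theorem deficiency_le_add {X : GammaSystem.{u, v} Γ} {f g : X → ℝ}
    (hf : AEStronglyMeasurable f X.μ) (hg : AEStronglyMeasurable g X.μ) :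
    deficiency C X f ≤ deficiency C X g + eLpNorm (f - g) 2 X.μ := by
  refine tsub_le_iff_right.1 (le_deficiency fun Y hY ψ h hh => tsub_le_iff_right.2 ?_)
  refine (deficiency_le hY ψ f hh).trans ?_
  have : f - h ∘ ψ = (g - h ∘ ψ) + (f - g) := by abel
  rw [this]
  exact eLpNorm_add_le (hg.sub (ψ.aestronglyMeasurable_comp hh)) (hf.sub hg) one_le_two

theorem lowerDeficiency_le_add {X : GammaSystem.{u, v} Γ} {f g : X → ℝ}
    (hf : AEStronglyMeasurable f X.μ) (hg : AEStronglyMeasurable g X.μ) :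
    lowerDeficiency C X f ≤ lowerDeficiency C X g + eLpNorm (f - g) 2 X.μ := by
  refine tsub_le_iff_right.1 (le_iInf fun X' => le_iInf fun π => tsub_le_iff_right.2 ?_)
  refine (lowerDeficiency_le π f).trans ((deficiency_le_add (π.aestronglyMeasurable_comp hf)
    (π.aestronglyMeasurable_comp hg)).trans ?_)
  gcongr
  exact (π.eLpNorm_comp (hf.sub hg) 2).le

theorem deficiency_congr {X : GammaSystem.{u, v} Γ} {f g : X → ℝ}
    (hf : AEStronglyMeasurable f X.μ) (h : f =ᵐ[X.μ] g) :
    deficiency C X f ≤ deficiency C X g := by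
  refine (deficiency_le_add hf (hf.congr h)).trans ?_
  have : f - g =ᵐ[X.μ] 0 := by filter_upwards [h] with x hx; simp [hx]
  rw [eLpNorm_congr_ae this]
  simp

theorem lowerDeficiency_congr {X : GammaSystem.{u, v} Γ} {f g : X → ℝ}
    (hf : AEStronglyMeasurable f X.μ) (h : f =ᵐ[X.μ] g) :
    lowerDeficiency C X f ≤ lowerDeficiency C X g := by
  refine (lowerDeficiency_le_add hf (hf.congr h)).trans ?_
  have : f - g =ᵐ[X.μ] 0 := by filter_upwards [h] with x hx; simp [hx]
  rw [eLpNorm_congr_ae this]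
  simp

/-- Compare with the zero function. Finiteness makes adding a positive `ε` a strict increase. -/
theorem lowerDeficiency_ne_top (hC : IsIdempotent C) {X : GammaSystem.{u, v} Γ} {f : X → ℝ}
    (hf : MemLp f 2 X.μ) : lowerDeficiency C X f ≠ ⊤ := by
  obtain ⟨Y, hY, ⟨ψ⟩⟩ := hC.exists_factorMap X
  refine ne_top_of_le_ne_top hf.2.ne ((lowerDeficiency_le (FactorMap.id X) f).trans
    ((deficiency_le hY ψ _ (h := 0) aestronglyMeasurable_zero).trans ?_))
  refine le_of_eq (congrArg (fun k => eLpNorm k 2 X.μ) ?_)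
  ext x
  simp [FactorMap.id]

/-- A nearly optimal extension with its `C`-factor may be replaced by their joint law: `f` and its
approximant both live there, so the distance is unchanged. -/
theorem exists_extension_deficiency_le (hC : IsIdempotent C) (X : GammaSystem.{u, v} Γ)
    {f : X → ℝ} (hf : MemLp f 2 X.μ) {ε : ENNReal} (hε : ε ≠ 0) :
    ∃ (X' : GammaSystem.{u, v} Γ) (p : FactorMap X' X),
      (∃ Y ∈ C, ∃ r : FactorMap X' Y, X'.measurableSpace ≤ p.sigma ⊔ r.sigma) ∧
      deficiency C X' (f ∘ p) ≤ lowerDeficiency C X f + ε := by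
  have hlt : lowerDeficiency C X f < lowerDeficiency C X f + ε :=
    ENNReal.lt_add_right (lowerDeficiency_ne_top hC hf) hε
  obtain ⟨X₁, h1⟩ := iInf_lt_iff.1 hlt
  obtain ⟨π, h2⟩ := iInf_lt_iff.1 h1
  obtain ⟨Y, h3⟩ := iInf_lt_iff.1 h2
  obtain ⟨hY, h4⟩ := iInf_lt_iff.1 h3
  obtain ⟨ψ, h5⟩ := iInf_lt_iff.1 h4
  obtain ⟨h, h6⟩ := iInf_lt_iff.1 h5
  obtain ⟨hh, h7⟩ := iInf_lt_iff.1 h6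
  let W : Bool → GammaSystem.{u, v} Γ := fun b => Bool.rec X Y b
  let φ : ∀ b, FactorMap X₁ (W b) := fun b => Bool.rec π ψ b
  let p : FactorMap (joint W φ) X := jointProj W φ false
  let r : FactorMap (joint W φ) Y := jointProj W φ true
  refine ⟨joint W φ, p, ⟨Y, hY, r, ?_⟩, ?_⟩
  · rw [joint_measurableSpace]
    exact iSup_le fun b => by cases b; exacts [le_sup_left, le_sup_right]
  · refine (deficiency_le hY r _ hh).trans (le_trans (le_of_eq ?_) h7.le)
    exact ((jointMap W φ).eLpNorm_comp ((p.aestronglyMeasurable_comp hf.1).sub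
      (r.aestronglyMeasurable_comp hh)) 2).symm

theorem FactorMap.Contains.comp {X Y Z X' : GammaSystem.{u, v} Γ} {ζ : FactorMap X Z}
    {ψ : FactorMap X Y} (h : ζ.Contains ψ) (π : FactorMap X' X) :
    (ζ.comp π).Contains (ψ.comp π) := by
  rintro _ ⟨s, hs, rfl⟩
  obtain ⟨_, ⟨t, ht, rfl⟩, hst⟩ := h _ ⟨s, hs, rfl⟩
  exact ⟨_, ⟨t, ht, rfl⟩, π.measurePreserving.quasiMeasurePreserving.preimage_ae_eq hst⟩

/-- Every `C`-factor is contained in `ζ`, so each competitor is measurable for `ζ` modulo null sets,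
where the conditional expectation is the closest choice. -/
theorem eLpNorm_sub_condExp_le_deficiency {X Z X' : GammaSystem.{u, v} Γ} {ζ : FactorMap X Z}
    (hζ : IsMaximalFactor C ζ) (π : FactorMap X' X) {f : X → ℝ} (hf : MemLp f 2 X.μ) :
    eLpNorm (f ∘ π - X'.μ[f ∘ π | (ζ.comp π).sigma]) 2 X'.μ ≤ deficiency C X f := by
  refine le_deficiency fun Y hY ψ h hh => ?_
  rw [← π.eLpNorm_comp (hf.1.sub (ψ.aestronglyMeasurable_comp hh)) 2]
  refine eLpNorm_sub_condExp_le (ζ.comp π).sigma_le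
    (hf.comp_measurePreserving π.measurePreserving) ?_
  obtain ⟨k, hk, hhk⟩ := hh
  have h1 : StronglyMeasurable[(ψ.comp π).sigma] (k ∘ ψ.comp π) :=
    hk.comp_measurable (comap_measurable _)
  exact (h1.aestronglyMeasurable_of_le_eventuallyMeasurableSpace
    ((hζ.contains Y ψ hY).comp π)).congr ((ψ.comp π).ae hhk.symm)

theorem isSated_of_deficiency_le (hC : IsIdempotent C) (X : GammaSystem.{u, v} Γ)
    (h : ∀ f : X → ℝ, StronglyMeasurable f → MemLp f ⊤ X.μ →
      deficiency C X f ≤ lowerDeficiency C X f) : IsSated C X := by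
  intro X' π
  obtain ⟨Z', ζ', hζ'⟩ := hC.exists_isMaximalFactor X'
  obtain ⟨Z, ζ, hζ⟩ := hC.exists_isMaximalFactor X
  refine ⟨Z', Z, ζ', ζ, hζ', hζ, fun f hf hfb => ?_⟩
  change _ = ∫ x, ∏ i, (X'.μ[f i | (ζ.comp π).sigma]) x ∂X'.μ
  simp only [Fin.prod_univ_two]
  obtain ⟨F, hF, hFf⟩ := StronglyMeasurable.exists_eq_measurable_comp (f := π) (hf 0)
  have hg : StronglyMeasurable[ζ'.sigma] (f 1) := hf 1
  have hFb := hfb 0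
  have hgb := hfb 1
  rw [hFf] at hFb ⊢
  generalize f 1 = g at *
  have hFX : MemLp F ⊤ X.μ := by
    rw [← π.measurePreserving.map_eq]
    exact (memLp_map_measure_iff hF.aestronglyMeasurable π.measurable.aemeasurable).2 hFb
  have hF2 : MemLp F 2 X.μ := hFX.mono_exponent le_top
  have hFπ : MemLp (F ∘ π) 2 X'.μ := hFb.mono_exponent le_top
  have hg2 : MemLp g 2 X'.μ := hgb.mono_exponent le_top
  have hm : (ζ.comp π).sigma ≤ X'.measurableSpace := (ζ.comp π).sigma_le
  set U := X'.μ[F ∘ π | (ζ.comp π).sigma]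
  have hU2 : MemLp U 2 X'.μ := hFπ.condExp one_le_two
  have hUm : AEStronglyMeasurable[ζ'.sigma] U X'.μ :=
    stronglyMeasurable_condExp.aestronglyMeasurable_of_le_eventuallyMeasurableSpace
      (hζ'.contains Z (ζ.comp π) hζ.mem)
  -- The chain of inequalities runs through both deficiencies of `F`: no `ζ'`-measurable function
  -- approximates `F ∘ π` better than `U`, although `U` sees only the maximal factor of `X`.
  have hmin : ∀ G : X' → ℝ, AEStronglyMeasurable[ζ'.sigma] G X'.μ →
      eLpNorm (F ∘ π - U) 2 X'.μ ≤ eLpNorm (F ∘ π - G) 2 X'.μ := by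
    intro G hG
    obtain ⟨k, hk, hGk⟩ := exists_ae_eq_comp_of_aestronglyMeasurable_comap hG
    refine (eLpNorm_sub_condExp_le_deficiency hζ π hF2).trans ((h F hF hFX).trans
      ((lowerDeficiency_le π F).trans ((deficiency_le hζ'.mem ζ' _ hk.aestronglyMeasurable).trans
        (le_of_eq (eLpNorm_congr_ae ?_)))))
    filter_upwards [hGk] with x hx
    simp [hx]
  -- `U + t • g` is a `ζ'`-measurable competitor for every `t`, because `ζ'` contains `ζ ∘ π`.
  have horth : ∫ x, (F ∘ π - U) x * g x ∂X'.μ = 0 := by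
    refine integral_mul_eq_zero_of_eLpNorm_le (hFπ.sub hU2) hg2 fun t => ?_
    rw [sub_sub]
    exact hmin _ (hUm.add (hg.const_smul t).aestronglyMeasurable)
  have hi1 : Integrable (fun x => (F ∘ π) x * g x) X'.μ := hFπ.integrable_mul hg2
  have hi2 : Integrable (fun x => U x * g x) X'.μ := hU2.integrable_mul hg2
  have h1 : ∫ x, (F ∘ π) x * g x ∂X'.μ = ∫ x, U x * g x ∂X'.μ := by
    rw [← sub_eq_zero, ← integral_sub hi1 hi2, ← horth]
    simp [sub_mul]
  rw [h1, ← integral_condExp hm]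
  refine integral_congr_ae ?_
  exact condExp_mul_of_stronglyMeasurable_left stronglyMeasurable_condExp hi2
    (hg2.integrable one_le_two)

end GammaSystem

/-! ### The tower and approximation in its limit -/

namespace GammaSystem

variable {Γ : Type v} [Semigroup Γ]

/-- A dense sequence in `L²` of a system. -/
noncomputable def denseFun (X : GammaSystem.{u, v} Γ) (j : ℕ) : X → ℝ :=
  haveI : Fact ((1 : ENNReal) ≤ 2) := ⟨one_le_two⟩
  haveI : Fact ((2 : ENNReal) ≠ ⊤) := ⟨by simp⟩
  (TopologicalSpace.denseSeq (Lp ℝ 2 X.μ) j : Lp ℝ 2 X.μ)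

theorem memLp_denseFun (X : GammaSystem.{u, v} Γ) (j : ℕ) : MemLp (X.denseFun j) 2 X.μ :=
  Lp.memLp _

theorem exists_eLpNorm_sub_denseFun_lt {X : GammaSystem.{u, v} Γ} {f : X → ℝ}
    (hf : MemLp f 2 X.μ) {ε : ENNReal} (hε : ε ≠ 0) :
    ∃ j, eLpNorm (f - X.denseFun j) 2 X.μ < ε := by
  have : Fact ((1 : ENNReal) ≤ 2) := ⟨one_le_two⟩
  have : Fact ((2 : ENNReal) ≠ ⊤) := ⟨by simp⟩
  obtain ⟨_, ⟨j, rfl⟩, hj⟩ := EMetric.mem_closure_iff.1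
    (TopologicalSpace.denseRange_denseSeq (Lp ℝ 2 X.μ) (hf.toLp f)) ε (pos_iff_ne_zero.2 hε)
  refine ⟨j, ?_⟩
  rw [Lp.edist_def] at hj
  refine lt_of_le_of_lt (le_of_eq (eLpNorm_congr_ae ?_)) hj
  filter_upwards [hf.coeFn_toLp] with x hx
  simp [hx, denseFun]

/-- A system together with a sequence of square-integrable functions on it. -/
structure MarkedSystem (Γ : Type v) [Semigroup Γ] where
  sys : GammaSystem.{u, v} Γ
  fn : ℕ → sys → ℝ
  memLp : ∀ k, MemLp (fn k) 2 sys.μ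

/-- A sequence of extensions in which step `n` nearly minimizes the deficiency of the function
number `(e n).2` with respect to the class number `(e n).1`. The function number
`Nat.pair m j` is member `j` of the dense sequence in `L²` of the system at level `m`. -/
theorem exists_tower {I : Type*} {C : I → Set (GammaSystem.{u, v} Γ)}
    (hC : ∀ i, IsIdempotent (C i)) (X₀ : GammaSystem.{u, v} Γ) (e : ℕ → I × ℕ) :
    ∃ (S : ℕ → MarkedSystem.{u, v} Γ) (p : ∀ n, FactorMap (S (n + 1)).sys (S n).sys)
      (π₀ : FactorMap (S 0).sys X₀), (S 0).sys.measurableSpace ≤ π₀.sigma ∧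
      (∀ m j, (S m).fn (Nat.pair m j) = (S m).sys.denseFun j) ∧
      (∀ n k, k.unpair.1 ≤ n → (S (n + 1)).fn k = (S n).fn k ∘ p n) ∧
      (∀ n, ∃ Y ∈ C (e n).1, ∃ r : FactorMap (S (n + 1)).sys Y,
        (S (n + 1)).sys.measurableSpace ≤ (p n).sigma ⊔ r.sigma) ∧
      ∀ n, deficiency (C (e n).1) (S (n + 1)).sys ((S n).fn (e n).2 ∘ p n) ≤
        lowerDeficiency (C (e n).1) (S n).sys ((S n).fn (e n).2) + ((n : ENNReal) + 1)⁻¹ := by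
  have hstep : ∀ (n : ℕ) (s : MarkedSystem.{u, v} Γ), ∃ (s' : MarkedSystem.{u, v} Γ)
      (p : FactorMap s'.sys s.sys),
      (∀ j, s'.fn (Nat.pair (n + 1) j) = s'.sys.denseFun j) ∧
      (∀ k, k.unpair.1 ≤ n → s'.fn k = s.fn k ∘ p) ∧
      (∃ Y ∈ C (e n).1, ∃ r : FactorMap s'.sys Y, s'.sys.measurableSpace ≤ p.sigma ⊔ r.sigma) ∧
      deficiency (C (e n).1) s'.sys (s.fn (e n).2 ∘ p) ≤
        lowerDeficiency (C (e n).1) s.sys (s.fn (e n).2) + ((n : ENNReal) + 1)⁻¹ := by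
    intro n s
    obtain ⟨X', p, hgen, hdef⟩ := exists_extension_deficiency_le (hC (e n).1) s.sys
      (s.memLp (e n).2) (ε := ((n : ENNReal) + 1)⁻¹)
      (ENNReal.inv_ne_zero.2 (by exact_mod_cast ENNReal.natCast_ne_top (n + 1)))
    -- Block `n + 1` receives the dense sequence of the new system. Lower blocks are lifted for
    -- good; higher blocks hold placeholders until their level is reached.
    refine ⟨⟨X', fun k => if k.unpair.1 = n + 1 then X'.denseFun k.unpair.2 else s.fn k ∘ p,
      fun k => ?_⟩, p, fun j => ?_, fun k hk => ?_, hgen, hdef⟩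
    · split_ifs
      · exact memLp_denseFun _ _
      · exact (s.memLp k).comp_measurePreserving p.measurePreserving
    · simp
    · exact if_neg (by omega)
  choose next p h1 h2 h3 h4 using hstep
  let s₀ : MarkedSystem.{u, v} Γ :=
    ⟨X₀, fun k => X₀.denseFun k.unpair.2, fun k => memLp_denseFun _ _⟩
  let S : ℕ → MarkedSystem.{u, v} Γ := fun n => Nat.rec s₀ next n
  refine ⟨S, fun n => p n (S n), FactorMap.id X₀, fun s hs => ⟨s, hs, rfl⟩, ?_,
    fun n => h2 n (S n), fun n => h3 n (S n), fun n => h4 n (S n)⟩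
  intro m j
  cases m with
  | zero => simp [S, s₀]
  | succ m => exact h1 m (S m) j

theorem exists_eLpNorm_sub_comp_denseFun_le {X : GammaSystem.{u, v} Γ}
    {sys : ℕ → GammaSystem.{u, v} Γ} (p : ∀ n, FactorMap (sys (n + 1)) (sys n))
    (q : ∀ n, FactorMap X (sys n)) (hq : ∀ n, ∀ᵐ x ∂X.μ, p n (q (n + 1) x) = q n x)
    (hgen : X.measurableSpace ≤ ⨆ n, (q n).sigma) {f : X → ℝ} (hf : StronglyMeasurable f)
    (hfb : MemLp f ⊤ X.μ) {ε : ENNReal} (hε : ε ≠ 0) :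
    ∃ m j, eLpNorm (f - (sys m).denseFun j ∘ q m) 2 X.μ ≤ ε := by
  -- The `(q n).sigma` increase only modulo null sets, so suprema are needed for a genuine
  -- filtration.
  let ℱ : Filtration ℕ X.measurableSpace :=
    { seq := fun n => ⨆ k ≤ n, (q k).sigma
      mono' := fun a b hab => iSup₂_le fun k hk => le_iSup₂_of_le k (hk.trans hab) le_rfl
      le' := fun n => iSup₂_le fun k _ => (q k).sigma_le }
  have hchain : ∀ n k, k ≤ n → (q k).sigma ≤ eventuallyMeasurableSpace (q n).sigma (ae X.μ) := by
    intro n k hk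
    induction n, hk using Nat.le_induction with
    | base => exact le_eventuallyMeasurableSpace
    | succ n hn ih =>
      refine ih.trans (eventuallyMeasurableSpace_le_of_le ?_)
      exact comap_le_eventuallyMeasurableSpace_of_ae_eq
        (g := p n ∘ q (n + 1)) ((p n).measurable.comp (comap_measurable _))
        ((hq n).mono fun _ h => h.symm)
  have hε2 : ε / 2 ≠ 0 := by simpa using hε
  obtain ⟨n, hn⟩ := exists_eLpNorm_sub_condExp_le ℱ
    (hgen.trans (iSup_le fun n => le_iSup_of_le n (le_iSup₂_of_le n le_rfl le_rfl)))
    hf.measurable hfb hε2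
  have hEm : AEStronglyMeasurable[(q n).sigma] (X.μ[f | ℱ n]) X.μ :=
    stronglyMeasurable_condExp.aestronglyMeasurable_of_le_eventuallyMeasurableSpace
      (iSup₂_le fun k hk => hchain n k hk)
  have hE2 : MemLp (X.μ[f | ℱ n]) 2 X.μ := (hfb.mono_exponent le_top).condExp one_le_two
  obtain ⟨g, hg, hEg⟩ := exists_ae_eq_comp_of_aestronglyMeasurable_comap hEm
  have hg2 : MemLp g 2 (sys n).μ := by
    rw [← (q n).measurePreserving.map_eq]
    exact (memLp_map_measure_iff hg.aestronglyMeasurable (q n).measurable.aemeasurable).2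
      (hE2.ae_eq hEg)
  obtain ⟨j, hj⟩ := exists_eLpNorm_sub_denseFun_lt hg2 hε2
  refine ⟨n, j, ?_⟩
  have hd := (memLp_denseFun (sys n) j).1
  have hgq := (q n).aestronglyMeasurable_comp hg.aestronglyMeasurable
  have hdq := (q n).aestronglyMeasurable_comp hd
  have hsplit : f - (sys n).denseFun j ∘ q n = (f - g ∘ q n) + (g - (sys n).denseFun j) ∘ q n := by
    ext x; simp
  rw [hsplit, ← ENNReal.add_halves ε]
  refine (eLpNorm_add_le (hf.aestronglyMeasurable.sub hgq) (hgq.sub hdq) one_le_two).trans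
    (add_le_add (le_trans (le_of_eq (eLpNorm_congr_ae ?_)) hn) ?_)
  · filter_upwards [hEg] with x hx
    simp [hx]
  · exact ((q n).eLpNorm_comp (hg.aestronglyMeasurable.sub hd) 2).trans_le hj.le

/-- Both quantities are 1-Lipschitz in `L²`, so the inequality survives approximation. -/
theorem deficiency_le_lowerDeficiency_of_approx {C : Set (GammaSystem.{u, v} Γ)}
    {X : GammaSystem.{u, v} Γ} {f : X → ℝ} (hf : AEStronglyMeasurable f X.μ)
    (h : ∀ ε : ENNReal, ε ≠ 0 → ∃ g : X → ℝ, AEStronglyMeasurable g X.μ ∧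
      deficiency C X g ≤ lowerDeficiency C X g ∧ eLpNorm (f - g) 2 X.μ ≤ ε) :
    deficiency C X f ≤ lowerDeficiency C X f := by
  refine ENNReal.le_of_forall_pos_le_add fun ε hε _ => ?_
  obtain ⟨g, hg, hgle, hfg⟩ := h (ε / 2) (by simpa using hε.ne')
  calc deficiency C X f ≤ deficiency C X g + eLpNorm (f - g) 2 X.μ := deficiency_le_add hf hg
    _ ≤ (lowerDeficiency C X f + eLpNorm (g - f) 2 X.μ) + eLpNorm (f - g) 2 X.μ := by
        gcongr
        exact hgle.trans (lowerDeficiency_le_add hg hf)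
    _ ≤ (lowerDeficiency C X f + ε / 2) + ε / 2 := by
        rw [eLpNorm_sub_comm g f]
        gcongr
    _ = lowerDeficiency C X f + ε := by rw [add_assoc, ENNReal.add_halves]

end GammaSystem

/-! ### The multiply sated extension -/

theorem mainTheorem5 {Γ : Type v} [Semigroup Γ] {I : Type*} [Countable I]
    (C : I → Set (GammaSystem.{u, v} Γ)) (hC : ∀ i, GammaSystem.IsIdempotent (C i))
    (X₀ : GammaSystem.{u, v} Γ) :
    ∃ (X : GammaSystem.{u, v} Γ) (π : GammaSystem.FactorMap X X₀),
      (∀ i, GammaSystem.IsSated (C i) X) ∧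
      ∃ (Z : I → GammaSystem.{u, v} Γ) (ζ : ∀ i, GammaSystem.FactorMap X (Z i)),
        (∀ i, GammaSystem.IsMaximalFactor (C i) (ζ i)) ∧
        X.GeneratesWhole (π.sigma ⊔ ⨆ i, (ζ i).sigma) := by
  rcases isEmpty_or_nonempty I with hI | hI
  · exact ⟨X₀, GammaSystem.FactorMap.id X₀, isEmptyElim, isEmptyElim, isEmptyElim, isEmptyElim,
      GammaSystem.generatesWhole_of_le fun s hs =>
        (le_sup_left : (GammaSystem.FactorMap.id X₀).sigma ≤ _) s ⟨s, hs, rfl⟩⟩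
  obtain ⟨a, ha⟩ := exists_surjective_nat (I × ℕ)
  -- Using only the second component of `n.unpair` makes every pair of a class and a function recur
  -- infinitely often.
  obtain ⟨S, p, π₀, hπ₀, hdense, hfn, hjoin, hdef⟩ :=
    GammaSystem.exists_tower hC X₀ fun n => a n.unpair.2
  obtain ⟨X, q, hq, hgen⟩ := GammaSystem.exists_inverseLimit (fun n => (S n).sys) p
  have hlift : ∀ k m n, k.unpair.1 ≤ m → m ≤ n →
      (S n).fn k ∘ q n =ᵐ[X.μ] (S m).fn k ∘ q m := by
    intro k m n hk hn
    induction n, hn using Nat.le_induction with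
    | base => exact ae_eq_rfl
    | succ n hn ih =>
      filter_upwards [ih, hq n] with x h1 h2
      rw [← h1, hfn n k (hk.trans hn)]
      simp [h2]
  have hstable : ∀ i m j, GammaSystem.deficiency (C i) X ((S m).sys.denseFun j ∘ q m) ≤
      GammaSystem.lowerDeficiency (C i) X ((S m).sys.denseFun j ∘ q m) := by
    intro i m j
    refine ENNReal.le_of_forall_pos_le_add fun ε hε _ => ?_
    obtain ⟨b, hb⟩ := ha (i, Nat.pair m j)
    obtain ⟨N, hN⟩ := ENNReal.exists_inv_nat_lt (a := (ε : ENNReal)) (by simpa using hε.ne')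
    let n := Nat.pair (max m N) b
    have hmax : max m N ≤ n := Nat.left_le_pair _ _
    have hmn : m ≤ n := (le_max_left _ _).trans hmax
    have hNn : N ≤ n := (le_max_right _ _).trans hmax
    have hn := hdef n
    have hen : a n.unpair.2 = (i, Nat.pair m j) := by simp [n, hb]
    rw [hen] at hn
    have hlim : (S n).fn (Nat.pair m j) ∘ q n =ᵐ[X.μ] (S m).sys.denseFun j ∘ q m := by
      have := hlift (Nat.pair m j) m n (by simp) hmn
      rwa [hdense] at this
    have hmeas := ((S n).memLp (Nat.pair m j)).1
    have hmeasq := (q n).aestronglyMeasurable_comp hmeas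
    have hlim' : ((S n).fn (Nat.pair m j) ∘ p n) ∘ q (n + 1) =ᵐ[X.μ]
        (S m).sys.denseFun j ∘ q m := by
      filter_upwards [hlim, hq n] with x h1 h2
      rw [← h1]
      simp [h2]
    have hmeasp := (p n).aestronglyMeasurable_comp hmeas
    calc GammaSystem.deficiency (C i) X ((S m).sys.denseFun j ∘ q m)
        ≤ GammaSystem.deficiency (C i) X (((S n).fn (Nat.pair m j) ∘ p n) ∘ q (n + 1)) :=
          GammaSystem.deficiency_congr (hmeasq.congr hlim) hlim'.symm
      _ ≤ GammaSystem.deficiency (C i) (S (n + 1)).sys ((S n).fn (Nat.pair m j) ∘ p n) :=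
          GammaSystem.deficiency_comp_le _ hmeasp
      _ ≤ GammaSystem.lowerDeficiency (C i) (S n).sys ((S n).fn (Nat.pair m j)) +
          ((n : ENNReal) + 1)⁻¹ := hn
      _ ≤ GammaSystem.lowerDeficiency (C i) X ((S n).fn (Nat.pair m j) ∘ q n) + ε := by
          gcongr
          · exact GammaSystem.lowerDeficiency_le_comp _ _
          · refine le_trans (ENNReal.inv_le_inv.2 ?_) hN.le
            exact_mod_cast hNn.trans (Nat.le_succ n)
      _ ≤ GammaSystem.lowerDeficiency (C i) X ((S m).sys.denseFun j ∘ q m) + ε := by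
          gcongr
          exact GammaSystem.lowerDeficiency_congr hmeasq hlim
  choose Z ζ hζ using fun i => (hC i).exists_isMaximalFactor X
  refine ⟨X, π₀.comp (q 0), fun i => GammaSystem.isSated_of_deficiency_le (hC i) X
    fun f hf hfb => ?_, Z, ζ, hζ, ?_⟩
  · refine GammaSystem.deficiency_le_lowerDeficiency_of_approx hf.aestronglyMeasurable fun ε hε => ?_
    obtain ⟨m, j, hmj⟩ :=
      GammaSystem.exists_eLpNorm_sub_comp_denseFun_le p q hq hgen hf hfb hε
    exact ⟨_, (q m).aestronglyMeasurable_comp (GammaSystem.memLp_denseFun _ j).1,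
      hstable i m j, hmj⟩
  -- Level `n + 1` is generated by level `n` and a factor in one of the classes; the latter, pulled
  -- back to `X`, is contained in the corresponding maximal factor.
  · refine hgen.trans (iSup_le fun n => ?_)
    induction n with
    | zero =>
      refine le_trans ?_ ((le_sup_left : (π₀.comp (q 0)).sigma ≤ _).trans
        le_eventuallyMeasurableSpace)
      rintro _ ⟨s, hs, rfl⟩
      obtain ⟨t, ht, rfl⟩ := hπ₀ s hs
      exact ⟨t, ht, rfl⟩
    | succ n ih =>
      obtain ⟨Y, hY, r, hr⟩ := hjoin n
      refine (MeasurableSpace.comap_mono hr).trans ?_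
      rw [MeasurableSpace.comap_sup, MeasurableSpace.comap_comp, MeasurableSpace.comap_comp]
      refine sup_le ?_ ?_
      · refine le_trans ?_ (eventuallyMeasurableSpace_le_of_le ih)
        exact comap_le_eventuallyMeasurableSpace_of_ae_eq (comap_measurable (q n)) (hq n)
      · refine ((hζ _).contains Y (r.comp (q (n + 1))) hY).trans
          (eventuallyMeasurableSpace_le_of_le ?_)
        exact ((le_iSup (fun i => (ζ i).sigma) _).trans le_sup_right).trans
          le_eventuallyMeasurableSpace
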